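/- An effect algebra is a set $E$ with an element $0$, a partial binary operation $\oplus$ and a total operation $x\mapsto x^\perp$ such that, writing $x\perp y$ when $x\oplus y$ is defined and $1:=0^\perp$: $\oplus$ is commutative and associative (in the partial sense: if $x\perp y$ then $y\perp x$ and $x\oplus y=y\oplus x$; if $x\perp y$ and $x\oplus y\perp z$ then $y\perp z$, $x\perp y\oplus z$ and $(x\oplus y)\oplus z=x\oplus(y\oplus z)$); $x\perp 0$ and $x\oplus 0=x$; $x^\perp$ is the unique element with $x\oplus x^\perp=1$; and $x\perp 1$ implies $x=0$. It is partially ordered by $x\le y$ iff $x\oplus z=y$ for some $z$. An effect monoid is an effect algebra with a total associative bi-additive multiplication (not assumed commutative) with unit $1$. It is directed complete if every non-empty upwards directed subset has a supremum. It is convex if there is an action $[0,1]\times E\to E$ of the real unit interval with $\lambda(\mu a)=(\lambda\mu)a$; $1a=a$; $\lambda a\perp\mu a$ and $\lambda a\oplus\mu a=(\lambda+\mu)a$ whenever $\lambda+\mu\le 1$; and $\lambda a\perp\lambda b$ and $\lambda(a\oplus b)=\lambda a\oplus\lambda b$ whenever $a\perp b$. A Boolean algebra is regarded as an effect monoid with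 $x\perp y$ iff $x\wedge y=0$, $x\oplus y=x\vee y$, $x^\perp$ the Boolean complement and $x\cdot y=x\wedge y$. The direct sum $M_1\oplus M_2$ is the Cartesian product with pointwise operations. A morphism of effect monoids is a map that preserves $1$, multiplication and all existing sums; an isomorphism is a bijective morphism whose inverse is a morphism. **Theorem.** Let $M$ be a directed-complete effect monoid. Then there is a convex directed-complete effect monoid $M_1$ and a complete Boolean algebra $M_2$ such that $M\cong M_1\oplus M_2$. More precisely: 1. the set $\{a\in M : a\perp a\}$ has a maximal element; 2. for every maximal element $a$ of this set, $p:=(a\oplus a)^\perp$ is an idempotent, every $s\le p$ is an idempotent, and there are a convex directed-complete effect monoid $M_1$, a complete Boolean algebra $M_2$ and an isomorphism of effect monoids $M\to M_1\oplus M_2$ that sends $p$ to $(0,1)$. -/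

import Mathlib

universe u v

/-- An effect algebra: a set with a distinguished element `0`, a partial sum
`osum x y` defined exactly when `Perp x y`, and a total complement `xᶜ`.
The unit is `1 = 0ᶜ`. -/
class EffectAlgebra (E : Type u) extends Zero E, Compl E where
  /-- The domain of definition of the partial sum. -/
  Perp : E → E → Prop
  /-- The partial sum. -/
  osum : ∀ x y : E, Perp x y → E
  osum_comm : ∀ (x y : E) (h : Perp x y), ∃ h' : Perp y x, osum x y h = osum y x h'
  osum_zero : ∀ x : E, ∃ h : Perp x 0, osum x 0 h = x
  osum_assoc : ∀ (x y z : E) (h₁ : Perp x y) (h₂ : Perp (osum x y h₁) z),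
    ∃ (h₃ : Perp y z) (h₄ : Perp x (osum y z h₃)),
      osum (osum x y h₁) z h₂ = osum x (osum y z h₃) h₄
  osum_compl : ∀ x : E, ∃ h : Perp x xᶜ, osum x xᶜ h = 0ᶜ
  compl_unique : ∀ (x y : E) (h : Perp x y), osum x y h = 0ᶜ → y = xᶜ
  eq_zero_of_perp_one : ∀ x : E, Perp x 0ᶜ → x = 0

namespace EffectAlgebra

section Order

variable {E : Type u} [EffectAlgebra E]

instance instOne : One E := ⟨0ᶜ⟩

theorem osum_left_cancel {x b c : E} (hb : Perp x b) (hc : Perp x c)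
    (h : osum x b hb = osum x c hc) : b = c := by
  have key : ∀ (y w : E) (hy : Perp x y) (hw : osum x y hy = w),
      ∃ k : Perp x wᶜ, y = (osum x wᶜ k)ᶜ := by
    intro y w hy hw
    subst hw
    obtain ⟨hy', e₁⟩ := osum_comm x y hy
    obtain ⟨h₁, e₂⟩ := osum_compl (osum x y hy)
    have h₁' : Perp (osum y x hy') (osum x y hy)ᶜ := e₁ ▸ h₁
    obtain ⟨h₃, h₄, e₃⟩ := osum_assoc y x _ hy' h₁'
    obtain ⟨h₅, e₄⟩ := osum_comm _ _ h₄
    refine ⟨h₃, compl_unique _ _ h₅ ?_⟩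
    rw [← e₄, ← e₃, ← e₂]
    congr 1
    exact e₁.symm
  obtain ⟨_, eb⟩ := key b _ hb h
  obtain ⟨_, ec⟩ := key c _ hc rfl
  exact eb.trans ec.symm

/-- The order of an effect algebra: `x ≤ y` when `y` is the sum of `x` and some element. -/
instance instPartialOrder : PartialOrder E where
  le x y := ∃ (z : E) (h : Perp x z), osum x z h = y
  le_refl x := ⟨0, osum_zero x⟩
  le_trans := by
    rintro x _ _ ⟨u, hu, rfl⟩ ⟨v, hv, rfl⟩
    obtain ⟨h₃, h₄, e⟩ := osum_assoc x u v hu hv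
    exact ⟨_, h₄, e.symm⟩
  le_antisymm := by
    rintro x _ ⟨u, hu, rfl⟩ ⟨v, hv, e⟩
    obtain ⟨h₃, h₄, e₁⟩ := osum_assoc x u v hu hv
    obtain ⟨h₀, e₀⟩ := osum_zero x
    have huv : osum u v h₃ = 0 :=
      osum_left_cancel h₄ h₀ (e₁.symm.trans (e.trans e₀.symm))
    obtain ⟨hvu, e₂⟩ := osum_comm u v h₃
    obtain ⟨k, -⟩ := osum_zero (0ᶜ : E)
    obtain ⟨k', -⟩ := osum_comm _ _ k
    have k'' : Perp (osum v u hvu) (0ᶜ : E) := by rw [← e₂, huv]; exact k'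
    obtain ⟨k₃, -, -⟩ := osum_assoc v u _ hvu k''
    have hu0 := eq_zero_of_perp_one u k₃
    subst hu0
    exact (osum_zero x).choose_spec.symm

end Order

/-- Every (non-empty, upwards) directed subset has a supremum. -/
def IsDirectedComplete (E : Type u) [EffectAlgebra E] : Prop :=
  ∀ S : Set E, S.Nonempty → DirectedOn (· ≤ ·) S → ∃ s : E, IsLUB S s

/-- An effect algebra is convex if it admits an action of the real unit interval
that is multiplicative and unital in the scalar and additive in each argument. -/
def IsConvex (E : Type u) [EffectAlgebra E] : Prop :=
  ∃ act : unitInterval → E → E,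
    (∀ (l m : unitInterval) (a : E), act l (act m a) = act (l * m) a) ∧
    (∀ (l m n : unitInterval) (a : E), (l : ℝ) + (m : ℝ) = (n : ℝ) →
      ∃ h : Perp (act l a) (act m a), osum (act l a) (act m a) h = act n a) ∧
    (∀ (l : unitInterval) (a b : E) (h : Perp a b),
      ∃ h' : Perp (act l a) (act l b), act l (osum a b h) = osum (act l a) (act l b) h') ∧
    (∀ a : E, act 1 a = a)

end EffectAlgebra

/-- An effect monoid: an effect algebra with a total, unital, associative and bi-additive
(not necessarily commutative) multiplication. -/
class EffectMonoid (M : Type u) extends EffectAlgebra M, Mul M where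
  mul_unit : ∀ a : M, a * 0ᶜ = a
  unit_mul : ∀ a : M, 0ᶜ * a = a
  mul_osum : ∀ (a b c : M) (h : Perp b c),
    ∃ h' : Perp (a * b) (a * c), a * osum b c h = osum (a * b) (a * c) h'
  osum_mul : ∀ (a b c : M) (h : Perp b c),
    ∃ h' : Perp (b * a) (c * a), osum b c h * a = osum (b * a) (c * a) h'
  mul_assoc' : ∀ a b c : M, a * (b * c) = (a * b) * c

namespace EffectMonoid

open EffectAlgebra

/-- The direct sum of two effect monoids: the Cartesian product with pointwise operations. -/
instance instProd (M : Type u) (N : Type v) [EffectMonoid M] [EffectMonoid N] :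
    EffectMonoid (M × N) where
  zero := (0, 0)
  compl x := (x.1ᶜ, x.2ᶜ)
  mul x y := (x.1 * y.1, x.2 * y.2)
  Perp x y := Perp x.1 y.1 ∧ Perp x.2 y.2
  osum x y h := (osum x.1 y.1 h.1, osum x.2 y.2 h.2)
  osum_comm x y h :=
    ⟨⟨(osum_comm _ _ h.1).choose, (osum_comm _ _ h.2).choose⟩,
      Prod.ext (osum_comm _ _ h.1).choose_spec (osum_comm _ _ h.2).choose_spec⟩
  osum_zero x :=
    ⟨⟨(osum_zero x.1).choose, (osum_zero x.2).choose⟩,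
      Prod.ext (osum_zero x.1).choose_spec (osum_zero x.2).choose_spec⟩
  osum_assoc x y z h₁ h₂ := by
    obtain ⟨a₁, b₁, e₁⟩ := osum_assoc _ _ _ h₁.1 h₂.1
    obtain ⟨a₂, b₂, e₂⟩ := osum_assoc _ _ _ h₁.2 h₂.2
    exact ⟨⟨a₁, a₂⟩, ⟨b₁, b₂⟩, Prod.ext e₁ e₂⟩
  osum_compl x :=
    ⟨⟨(osum_compl x.1).choose, (osum_compl x.2).choose⟩,
      Prod.ext (osum_compl x.1).choose_spec (osum_compl x.2).choose_spec⟩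
  compl_unique x y h e :=
    Prod.ext (compl_unique _ _ h.1 (congrArg Prod.fst e))
      (compl_unique _ _ h.2 (congrArg Prod.snd e))
  eq_zero_of_perp_one x h :=
    Prod.ext (eq_zero_of_perp_one _ h.1) (eq_zero_of_perp_one _ h.2)
  mul_unit a := Prod.ext (mul_unit a.1) (mul_unit a.2)
  unit_mul a := Prod.ext (unit_mul a.1) (unit_mul a.2)
  mul_osum a b c h :=
    ⟨⟨(mul_osum a.1 _ _ h.1).choose, (mul_osum a.2 _ _ h.2).choose⟩,
      Prod.ext (mul_osum a.1 _ _ h.1).choose_spec (mul_osum a.2 _ _ h.2).choose_spec⟩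
  osum_mul a b c h :=
    ⟨⟨(osum_mul a.1 _ _ h.1).choose, (osum_mul a.2 _ _ h.2).choose⟩,
      Prod.ext (osum_mul a.1 _ _ h.1).choose_spec (osum_mul a.2 _ _ h.2).choose_spec⟩
  mul_assoc' a b c := Prod.ext (mul_assoc' _ _ _) (mul_assoc' _ _ _)

/-- A Boolean algebra as an effect monoid: `x` and `y` are summable when disjoint, their sum is
then the join, the complement is the Boolean complement, and the product is the meet. -/
abbrev ofBooleanAlgebra (B : Type u) [BooleanAlgebra B] : EffectMonoid B where
  zero := ⊥
  compl x := xᶜ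
  mul x y := x ⊓ y
  Perp x y := Disjoint x y
  osum x y _ := x ⊔ y
  osum_comm x y h := ⟨h.symm, sup_comm x y⟩
  osum_zero x := ⟨disjoint_bot_right, sup_bot_eq x⟩
  osum_assoc x y z _ h₂ :=
    ⟨(disjoint_sup_left.1 h₂).2,
      disjoint_sup_right.2 ⟨by assumption, (disjoint_sup_left.1 h₂).1⟩, sup_assoc x y z⟩
  osum_compl x := ⟨disjoint_compl_right, sup_compl_eq_top.trans compl_bot.symm⟩
  compl_unique x y h e :=
    ((IsCompl.of_eq h.eq_bot (e.trans compl_bot)).compl_eq).symm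
  eq_zero_of_perp_one x h := disjoint_top.1 ((compl_bot (α := B)) ▸ h)
  mul_unit a := (congrArg (a ⊓ ·) compl_bot).trans (inf_top_eq a)
  unit_mul a := (congrArg (· ⊓ a) compl_bot).trans (top_inf_eq a)
  mul_osum a _ _ h := ⟨h.mono inf_le_right inf_le_right, inf_sup_left a _ _⟩
  osum_mul a _ _ h := ⟨h.mono inf_le_left inf_le_left, inf_sup_right _ _ a⟩
  mul_assoc' a b c := (inf_assoc a b c).symm

/-- A morphism of effect monoids. -/
structure IsHom {M : Type u} {N : Type v} [EffectMonoid M] [EffectMonoid N]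
    (f : M → N) : Prop where
  map_one : f 1 = 1
  map_osum : ∀ (x y : M) (h : Perp x y),
    ∃ h' : Perp (f x) (f y), f (osum x y h) = osum (f x) (f y) h'
  map_mul : ∀ x y : M, f (x * y) = f x * f y

/-- An isomorphism of effect monoids: a bijective morphism whose inverse is a morphism. -/
structure Iso (M : Type u) (N : Type v) [EffectMonoid M] [EffectMonoid N]
    extends M ≃ N where
  isHom_toFun : IsHom toFun
  isHom_invFun : IsHom invFun

end EffectMonoid

-- Let `a` be maximal among the self-summable elements and `p = (a ⊕ a)ᶜ`. If `x` is self-summable,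
-- then `p * x` doubles to something below `p`, so `a ⊕ p * x` is still self-summable; maximality
-- forces `p * x = 0` (`mul_eq_zero_of_perp_self`). Taking `x = a` gives `p * pᶜ = 0`, so `p` is
-- idempotent. Taking `x = s * sᶜ` with `s ≤ p`, which is self-summable because it lies below both
-- `s` and `sᶜ`, shows that `s` is idempotent.
--
-- Idempotents are central, so `M` splits into the corners at `pᶜ` and `p` (`cornerIso`). The corner
-- at `p` consists of idempotents, hence is a Boolean algebra with product as meet, complete because
-- arbitrary joins are directed suprema of finite ones.
--
-- In the corner at `pᶜ` the unit is `a ⊕ a`. Multiplying by `a` halves elements, so dyadic scalars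
-- exist, and real scalars arise as suprema. Exact additivity and uniqueness both rest on the
-- absence of infinitesimals: an element all of whose multiples exist is zero
-- (`eq_zero_of_nsmul_ne_top`). Uniqueness then makes the scalars multiplicative.

universe w

/-! ### Totalization: partial sums as an ordered commutative monoid -/

namespace EffectAlgebra

/-- An effect algebra with an absorbing top element added: the value of all undefined sums. -/
def Ext (E : Type u) : Type u := WithTop E

namespace Ext

/-- The inclusion of an effect algebra in its totalization. -/
def of (x : E) : Ext E := WithTop.some x

@[simp] theorem of_inj {E : Type u} {x y : E} : of x = of y ↔ x = y := WithTop.coe_inj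

variable {E : Type u} [EffectAlgebra E]

instance : PartialOrder (Ext E) := inferInstanceAs (PartialOrder (WithTop E))

instance : OrderTop (Ext E) := inferInstanceAs (OrderTop (WithTop E))

@[elab_as_elim]
theorem ind {P : Ext E → Prop} (top : P ⊤) (of : ∀ x, P (of x)) (u : Ext E) : P u :=
  WithTop.recTopCoe top of u

@[simp] theorem of_ne_top (x : E) : of x ≠ ⊤ := WithTop.coe_ne_top

@[simp] theorem top_ne_of (x : E) : ⊤ ≠ of x := WithTop.top_ne_coe

@[simp] theorem of_le_of {x y : E} : of x ≤ of y ↔ x ≤ y := WithTop.coe_le_coe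

theorem exists_of_ne_top {u : Ext E} (h : u ≠ ⊤) : ∃ x, u = of x := by
  induction u using ind with
  | top => exact absurd rfl h
  | of x => exact ⟨x, rfl⟩

theorem exists_of_le {u : Ext E} {y : E} (h : u ≤ of y) : ∃ x, u = of x :=
  exists_of_ne_top fun e => of_ne_top y (top_le_iff.1 (e ▸ h))

/-- Reduces an identity of possibly undefined sums to following defined values in both directions,
which is the form the partial axioms take. -/
theorem eq_of_forall_of {u v : Ext E} (h₁ : ∀ t, u = of t → v = of t)
    (h₂ : ∀ t, v = of t → u = of t) : u = v := by
  induction u using ind with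
  | of x => exact (h₁ x rfl).symm
  | top =>
    induction v using ind with
    | of y => exact h₂ y rfl
    | top => rfl

open Classical in
noncomputable instance : Add (Ext E) where
  add u v := WithTop.recTopCoe (C := fun _ => Ext E) ⊤
    (fun x => WithTop.recTopCoe (C := fun _ => Ext E) ⊤
      (fun y => if h : Perp x y then of (osum x y h) else ⊤) v) u

instance : Zero (Ext E) := ⟨of 0⟩

theorem of_zero : of (0 : E) = 0 := rfl

theorem of_add_osum {x y : E} (h : Perp x y) : of x + of y = of (osum x y h) := dif_pos h

theorem of_add_eq_of {x y z : E} : of x + of y = of z ↔ ∃ h : Perp x y, osum x y h = z := by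
  by_cases h : Perp x y
  · rw [of_add_osum h, of_inj]
    exact ⟨fun e => ⟨h, e⟩, fun e => e.2⟩
  · have : of x + of y = ⊤ := dif_neg h
    rw [this]
    exact ⟨fun e => absurd e (top_ne_of z), fun e => absurd e.1 h⟩

theorem perp_iff {x y : E} : Perp x y ↔ of x + of y ≠ ⊤ := by
  constructor
  · intro h
    rw [of_add_osum h]
    exact of_ne_top _
  · intro h
    obtain ⟨z, hz⟩ := exists_of_ne_top h
    exact (of_add_eq_of.1 hz).1

theorem perp_of_add_eq {x y z : E} (h : of x + of y = of z) : Perp x y := (of_add_eq_of.1 h).1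

theorem perp_of_add_le {x y z : E} (h : of x + of y ≤ of z) : Perp x y :=
  perp_of_add_eq (exists_of_le h).choose_spec

theorem add_top' (u : Ext E) : u + ⊤ = ⊤ := by
  induction u using ind <;> rfl

theorem add_comm' (u v : Ext E) : u + v = v + u := by
  have key : ∀ (u v : Ext E) (t : E), u + v = of t → v + u = of t := by
    intro u v t
    induction u using ind with
    | top => exact fun h => absurd h (top_ne_of t)
    | of x =>
      induction v using ind with
      | top => exact fun h => absurd h (top_ne_of t)
      | of y =>
        intro h
        obtain ⟨k, rfl⟩ := of_add_eq_of.1 h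
        obtain ⟨h', e⟩ := osum_comm x y k
        exact of_add_eq_of.2 ⟨h', e.symm⟩
  exact eq_of_forall_of (key u v) (key v u)

theorem exists_of_add_eq {u v : Ext E} {t : E} (h : u + v = of t) :
    ∃ x y, u = of x ∧ v = of y := by
  induction u using ind with
  | top => exact absurd h (top_ne_of t)
  | of x =>
    induction v using ind with
    | top => exact absurd h (top_ne_of t)
    | of y => exact ⟨x, y, rfl, rfl⟩

theorem add_assoc' (u v w : Ext E) : u + v + w = u + (v + w) := by
  have key : ∀ (u v w : Ext E) (t : E), u + v + w = of t → u + (v + w) = of t := by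
    intro u v w t h
    obtain ⟨s, z, hs, rfl⟩ := exists_of_add_eq h
    obtain ⟨x, y, rfl, rfl⟩ := exists_of_add_eq hs
    rw [hs] at h
    obtain ⟨h₁, rfl⟩ := of_add_eq_of.1 hs
    obtain ⟨h₂, rfl⟩ := of_add_eq_of.1 h
    obtain ⟨h₃, h₄, e⟩ := osum_assoc x y z h₁ h₂
    rw [of_add_osum h₃, of_add_osum h₄, e]
  refine eq_of_forall_of (key u v w) fun t h => ?_
  rw [add_comm' u, add_comm' v] at h
  rw [add_comm', add_comm' u]
  exact key _ _ _ _ h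

theorem add_zero' (u : Ext E) : u + 0 = u := by
  induction u using ind with
  | top => rfl
  | of x =>
    obtain ⟨h, e⟩ := osum_zero x
    exact of_add_eq_of.2 ⟨h, e⟩

noncomputable instance : AddCommMonoid (Ext E) where
  add_assoc := add_assoc'
  add_comm := add_comm'
  zero_add u := (add_comm' 0 u).trans (add_zero' u)
  add_zero := add_zero'
  nsmul := nsmulRec

theorem of_le_of_iff {x y : E} : x ≤ y ↔ ∃ z, of x + of z = of y := by
  simp only [of_add_eq_of]
  exact Iff.rfl

theorem le_iff_exists {u v : Ext E} : u ≤ v ↔ ∃ w, u + w = v := by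
  induction v using ind with
  | top => exact ⟨fun _ => ⟨⊤, add_top' u⟩, fun _ => le_top⟩
  | of y =>
    constructor
    · intro h
      obtain ⟨x, rfl⟩ := exists_of_le h
      obtain ⟨z, hz⟩ := of_le_of_iff.1 (of_le_of.1 h)
      exact ⟨of z, hz⟩
    · rintro ⟨w, h⟩
      obtain ⟨x, z, rfl, rfl⟩ := exists_of_add_eq h
      exact of_le_of.2 (of_le_of_iff.2 ⟨z, h⟩)

instance : IsOrderedAddMonoid (Ext E) where
  add_le_add_left u v h w := by
    obtain ⟨t, rfl⟩ := le_iff_exists.1 h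
    exact le_iff_exists.2 ⟨t, add_right_comm u w t⟩

theorem le_add (u v : Ext E) : u ≤ u + v := le_iff_exists.2 ⟨v, rfl⟩

theorem zero_le' (u : Ext E) : 0 ≤ u := le_iff_exists.2 ⟨u, zero_add u⟩

/-- Cancellation fails at `⊤`, hence the requirement that the common value be a genuine element. -/
theorem add_left_cancel_of {u v w : Ext E} {t : E} (h : u + v = of t) (h' : u + w = of t) :
    v = w := by
  obtain ⟨x, y, rfl, rfl⟩ := exists_of_add_eq h
  obtain ⟨_, z, -, rfl⟩ := exists_of_add_eq h'
  obtain ⟨k, e⟩ := of_add_eq_of.1 h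
  obtain ⟨k', e'⟩ := of_add_eq_of.1 h'
  exact congrArg of (osum_left_cancel k k' (e.trans e'.symm))

theorem le_of_add_le_add_of {u v w : Ext E} {t : E} (h : u + v ≤ u + w) (ht : u + w = of t) :
    v ≤ w := by
  obtain ⟨r, hr⟩ := le_iff_exists.1 h
  rw [add_assoc] at hr
  exact le_iff_exists.2 ⟨r, add_left_cancel_of (hr.trans ht) ht⟩

theorem of_add_compl (x : E) : of x + of xᶜ = of 1 := of_add_eq_of.2 (osum_compl x)

theorem nsmul_mono_left (u : Ext E) {m n : ℕ} (h : m ≤ n) : m • u ≤ n • u := by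
  obtain ⟨k, rfl⟩ := Nat.exists_eq_add_of_le h
  rw [add_nsmul]
  exact le_add _ _

end Ext

/-! ### Complements, suprema and infinitesimals -/

open Ext

variable {E : Type u} [EffectAlgebra E]

theorem zero_le_all (x : E) : 0 ≤ x := of_le_of.1 (Ext.zero_le' (of x))

theorem le_one_all (x : E) : x ≤ 1 := of_le_of_iff.2 ⟨_, of_add_compl x⟩

theorem eq_zero_of_le_zero {x : E} (h : x ≤ 0) : x = 0 := le_antisymm h (zero_le_all x)

theorem compl_zero_eq_one : (0 : E)ᶜ = 1 := rfl

theorem compl_compl_eq (x : E) : xᶜᶜ = x :=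
  have ⟨h, e⟩ := of_add_eq_of.1 ((add_comm (of xᶜ) (of x)).trans (of_add_compl x))
  (compl_unique xᶜ x h e).symm

theorem perp_iff_le_compl {x y : E} : Perp x y ↔ x ≤ yᶜ := by
  constructor
  · intro h
    refine of_le_of.1 (le_of_add_le_add_of (u := of y) ?_ (of_add_compl y))
    rw [of_add_compl, add_comm, of_add_osum h]
    exact of_le_of.2 (le_one_all _)
  · intro h
    refine perp_of_add_le (z := 1) ?_
    rw [← of_add_compl y, add_comm (of x)]
    exact add_le_add_right (of_le_of.2 h) _

theorem perp_comm {x y : E} : Perp x y ↔ Perp y x := by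
  rw [perp_iff, perp_iff, add_comm]

theorem compl_le_compl_of_le {x y : E} (h : x ≤ y) : yᶜ ≤ xᶜ := by
  rw [← perp_iff_le_compl, perp_comm, perp_iff_le_compl, compl_compl_eq]
  exact h

theorem le_compl_comm {x y : E} : x ≤ yᶜ ↔ y ≤ xᶜ := by
  rw [← perp_iff_le_compl, perp_comm, perp_iff_le_compl]

/-- Adding a fixed element is compatible with suprema. -/
theorem add_le_of_isLUB {S : Set E} {s z : E} {v : Ext E} (hS : S.Nonempty) (hs : IsLUB S s)
    (h : ∀ x ∈ S, of x + v ≤ of z) : of s + v ≤ of z := by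
  obtain ⟨x₀, hx₀⟩ := hS
  have hv : v ≤ of z := le_trans (by rw [add_comm]; exact le_add _ _) (h x₀ hx₀)
  -- The difference of `z` and `v` is an upper bound of `S`; non-emptiness of `S` is what makes it
  -- exist.
  obtain ⟨w, hw⟩ := le_iff_exists.1 hv
  obtain ⟨y, c, rfl, rfl⟩ := exists_of_add_eq hw
  have hc : s ≤ c := hs.2 fun x hx => of_le_of.1 <| by
    refine le_of_add_le_add_of (u := of y) ?_ hw
    rw [hw, add_comm]
    exact h x hx
  rw [← hw, add_comm]
  exact add_le_add_right (of_le_of.2 hc) _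

theorem eq_zero_of_add_le_self {x d : E} (h : of x + of d ≤ of x) : d = 0 :=
  eq_zero_of_le_zero <| of_le_of.1 <|
    le_of_add_le_add_of (u := of x) (h.trans_eq (add_zero _).symm) (add_zero _)

/-- A directed-complete effect algebra has no non-zero infinitesimals. -/
theorem eq_zero_of_nsmul_ne_top (hE : IsDirectedComplete E) {d : E}
    (h : ∀ n : ℕ, n • of d ≠ ⊤) : d = 0 := by
  obtain ⟨s, hs⟩ := hE {x | ∃ n : ℕ, of x = n • of d} ⟨0, 0, (zero_nsmul _).symm⟩ (by
    rintro x ⟨m, hm⟩ y ⟨n, hn⟩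
    rcases le_total m n with hmn | hmn
    · exact ⟨y, ⟨n, hn⟩, of_le_of.1 (by rw [hm, hn]; exact nsmul_mono_left _ hmn), le_rfl⟩
    · exact ⟨x, ⟨m, hm⟩, le_rfl, of_le_of.1 (by rw [hm, hn]; exact nsmul_mono_left _ hmn)⟩)
  -- The supremum `s` of the multiples of `d` absorbs `d`, since adding `d` to a multiple gives the
  -- next one.
  refine eq_zero_of_add_le_self (add_le_of_isLUB ?_ hs ?_)
  · exact ⟨0, 0, (zero_nsmul _).symm⟩
  rintro x ⟨n, hn⟩
  obtain ⟨y, hy⟩ := exists_of_ne_top (h (n + 1))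
  rw [hn, ← succ_nsmul, hy]
  exact of_le_of.2 (hs.1 ⟨n + 1, hy.symm⟩)

theorem exists_maximal_perp_self (hE : IsDirectedComplete E) :
    ∃ a : E, Maximal (fun x : E => Perp x x) a := by
  obtain ⟨a, -, ha⟩ := zorn_le_nonempty₀ {x : E | Perp x x} (by
    intro c hc hchain y hy
    obtain ⟨s, hs⟩ := hE c ⟨y, hy⟩ hchain.directedOn
    -- Any two members of the chain are summable, because the larger one is self-summable; pass to
    -- the supremum in one variable, then in the other.
    refine ⟨s, perp_iff_le_compl.2 (hs.2 fun x hx => le_compl_comm.1 (hs.2 fun z hz => ?_)), hs.1⟩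
    rcases hchain.total hx hz with h | h
    · exact le_compl_comm.1 (h.trans (perp_iff_le_compl.1 (hc hz)))
    · exact h.trans (perp_iff_le_compl.1 (hc hx))) 0
    (osum_zero (0 : E)).1
  exact ⟨a, ha⟩

end EffectAlgebra

namespace EffectMonoid

open EffectAlgebra EffectAlgebra.Ext

/-! ### Multiplication, idempotents and the maximal self-summable element -/

section Basic

variable {M : Type u} [EffectMonoid M]

theorem mul_one' (a : M) : a * 1 = a := mul_unit a

theorem one_mul' (a : M) : 1 * a = a := unit_mul a

theorem mul_add_of (a : M) {b c d : M} (h : of b + of c = of d) :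
    of (a * b) + of (a * c) = of (a * d) := by
  obtain ⟨k, rfl⟩ := of_add_eq_of.1 h
  obtain ⟨h', e⟩ := mul_osum a b c k
  exact of_add_eq_of.2 ⟨h', e.symm⟩

theorem add_mul_of (a : M) {b c d : M} (h : of b + of c = of d) :
    of (b * a) + of (c * a) = of (d * a) := by
  obtain ⟨k, rfl⟩ := of_add_eq_of.1 h
  obtain ⟨h', e⟩ := osum_mul a b c k
  exact of_add_eq_of.2 ⟨h', e.symm⟩

theorem mul_le_mul_left_of (a : M) {b c : M} (h : b ≤ c) : a * b ≤ a * c := by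
  obtain ⟨d, hd⟩ := of_le_of_iff.1 h
  exact of_le_of_iff.2 ⟨_, mul_add_of a hd⟩

theorem mul_le_mul_right_of (a : M) {b c : M} (h : b ≤ c) : b * a ≤ c * a := by
  obtain ⟨d, hd⟩ := of_le_of_iff.1 h
  exact of_le_of_iff.2 ⟨_, add_mul_of a hd⟩

theorem mul_le_left (a b : M) : a * b ≤ a :=
  (mul_le_mul_left_of a (le_one_all b)).trans_eq (mul_one' a)

theorem mul_le_right (a b : M) : a * b ≤ b :=
  (mul_le_mul_right_of b (le_one_all a)).trans_eq (one_mul' b)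

theorem mul_zero' (a : M) : a * 0 = 0 := eq_zero_of_le_zero (mul_le_right a 0)

theorem mul_add_mul_compl (a b : M) : of (a * b) + of (a * bᶜ) = of a :=
  (mul_add_of a (of_add_compl b)).trans (congrArg of (mul_one' a))

theorem mul_add_compl_mul (a b : M) : of (b * a) + of (bᶜ * a) = of a :=
  (add_mul_of a (of_add_compl b)).trans (congrArg of (one_mul' a))

theorem eq_of_add_eq_left {a b : M} (h : of a + of b = of a) : b = 0 :=
  of_inj.1 (add_left_cancel_of h (add_zero (of a)))

/-- Both products are the difference of `s` and `s * s`. -/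
theorem mul_compl_comm (s : M) : s * sᶜ = sᶜ * s :=
  of_inj.1 (add_left_cancel_of (mul_add_mul_compl s s) (mul_add_compl_mul s s))

theorem perp_mul_compl_self (s : M) : Perp (s * sᶜ) (s * sᶜ) := by
  rw [perp_iff_le_compl]
  refine (mul_le_left s sᶜ).trans (le_compl_comm.1 (mul_le_right s sᶜ))

theorem isIdempotentElem_of_mul_compl {s : M} (h : s * sᶜ = 0) : IsIdempotentElem s := by
  have := mul_add_mul_compl s s
  rw [h, of_zero, add_zero] at this
  exact of_inj.1 this

theorem perp_of_le_compl {p x y : M} (hx : x ≤ pᶜ) (hy : y ≤ p) : Perp x y :=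
  perp_iff_le_compl.2 (hx.trans (compl_le_compl_of_le hy))

section Idempotent

variable {p : M} (hp : IsIdempotentElem p)
include hp

theorem mul_compl_self : p * pᶜ = 0 := by
  have := mul_add_mul_compl p p
  rw [hp.eq] at this
  exact eq_of_add_eq_left this

theorem compl_mul_self : pᶜ * p = 0 := (mul_compl_comm p).symm.trans (mul_compl_self hp)

theorem isIdempotentElem_compl : IsIdempotentElem pᶜ :=
  isIdempotentElem_of_mul_compl (by rw [compl_compl_eq, compl_mul_self hp])

theorem mul_eq_of_le {x : M} (h : x ≤ p) : p * x = x := by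
  have h0 : pᶜ * x = 0 :=
    eq_zero_of_le_zero ((mul_le_mul_left_of _ h).trans_eq (compl_mul_self hp))
  have := mul_add_compl_mul x p
  rw [h0, of_zero, add_zero] at this
  exact of_inj.1 this

theorem mul_eq_of_le' {x : M} (h : x ≤ p) : x * p = x := by
  have h0 : x * pᶜ = 0 :=
    eq_zero_of_le_zero ((mul_le_mul_right_of _ h).trans_eq (mul_compl_self hp))
  have := mul_add_mul_compl x p
  rw [h0, of_zero, add_zero] at this
  exact of_inj.1 this

/-- Idempotents are central. -/
theorem mul_comm_of_isIdempotentElem (x : M) : p * x = x * p := by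
  -- Both sides equal `p * x * p`.
  rw [← mul_eq_of_le' hp (mul_le_left p x), ← mul_assoc',
    mul_eq_of_le hp (mul_le_right x p)]

theorem mul_eq_zero_of_le_compl {x : M} (h : x ≤ pᶜ) : p * x = 0 :=
  eq_zero_of_le_zero ((mul_le_mul_left_of _ h).trans_eq (mul_compl_self hp))

theorem osum_le {x y : M} (hx : x ≤ p) (hy : y ≤ p) (h : Perp x y) : osum x y h ≤ p := by
  have e := mul_add_of p (of_add_osum h)
  rw [mul_eq_of_le hp hx, mul_eq_of_le hp hy, of_add_osum h, of_inj] at e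
  rw [e]
  exact mul_le_left p _

end Idempotent

/-- If `p` is the complement of the double of a maximal self-summable element, then `p`
annihilates the self-summable elements. -/
theorem mul_eq_zero_of_perp_self {a : M} (ha : Maximal (fun x : M => Perp x x) a) {x : M}
    (hx : Perp x x) : (osum a a ha.prop)ᶜ * x = 0 := by
  set p := (osum a a ha.prop)ᶜ with hp
  have h1 : of a + of a + of p = of 1 := by
    rw [of_add_osum ha.prop, hp, of_add_compl]
  have h2 : of (p * x) + of (p * x) ≤ of p := by
    rw [mul_add_of p (of_add_osum hx), of_le_of]
    exact mul_le_left p _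
  have h3 : (of a + of (p * x)) + (of a + of (p * x)) ≤ of 1 := by
    rw [add_add_add_comm, ← h1]
    exact add_le_add_right h2 _
  obtain ⟨b, hb⟩ := exists_of_le ((le_add _ _).trans h3)
  rw [hb] at h3
  have hab : a ≤ b := of_le_of_iff.2 ⟨_, hb⟩
  refine eq_zero_of_add_le_self (x := a) ?_
  rw [hb, of_le_of]
  exact ha.2 (perp_of_add_le h3) hab

theorem isIdempotentElem_of_maximal {a : M} (ha : Maximal (fun x : M => Perp x x) a) :
    IsIdempotentElem (osum a a ha.prop)ᶜ := by
  have h := mul_add_of (osum a a ha.prop)ᶜ (of_add_osum ha.prop)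
  rw [mul_eq_zero_of_perp_self ha ha.prop, of_zero, add_zero, ← of_zero, of_inj] at h
  exact isIdempotentElem_of_mul_compl (by rw [compl_compl_eq, ← h])

theorem isIdempotentElem_of_le_of_maximal {a : M} (ha : Maximal (fun x : M => Perp x x) a)
    {s : M} (hs : s ≤ (osum a a ha.prop)ᶜ) : IsIdempotentElem s := by
  refine isIdempotentElem_of_mul_compl ?_
  rw [← mul_eq_of_le (isIdempotentElem_of_maximal ha) ((mul_le_left s sᶜ).trans hs)]
  exact mul_eq_zero_of_perp_self ha (perp_mul_compl_self s)

end Basic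

/-! ### Isomorphisms of effect monoids -/

section Morphisms

variable {M : Type u} {N : Type v} [EffectMonoid M] [EffectMonoid N]

/-- A bijective morphism that reflects summability is an isomorphism. -/
noncomputable def Iso.ofBijective (f : M → N) (hf : IsHom f) (hb : Function.Bijective f)
    (hr : ∀ x y, Perp (f x) (f y) → Perp x y) : Iso M N :=
  let e := Equiv.ofBijective f hb
  { e with
    isHom_toFun := hf
    isHom_invFun := by
      have he : ∀ y, f (e.symm y) = y := e.apply_symm_apply
      refine ⟨hb.1 ?_, fun x y h => ?_, fun x y => hb.1 ?_⟩
      · exact (he 1).trans hf.map_one.symm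
      · have h' : Perp (e.symm x) (e.symm y) := hr _ _ (by rwa [he, he])
        refine ⟨h', hb.1 ?_⟩
        obtain ⟨k, hk⟩ := hf.map_osum _ _ h'
        refine ((he _).trans ?_).trans hk.symm
        congr 1
        · exact (he x).symm
        · exact (he y).symm
      · exact (he _).trans ((congrArg₂ _ (he x) (he y)).symm.trans (hf.map_mul _ _).symm) }

theorem IsHom.comp {O : Type w} [EffectMonoid O] {g : N → O} {f : M → N} (hg : IsHom g)
    (hf : IsHom f) : IsHom (g ∘ f) where
  map_one := (congrArg g hf.map_one).trans hg.map_one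
  map_osum x y h := by
    obtain ⟨h₁, e₁⟩ := hf.map_osum x y h
    obtain ⟨h₂, e₂⟩ := hg.map_osum _ _ h₁
    exact ⟨h₂, (congrArg g e₁).trans e₂⟩
  map_mul x y := (congrArg g (hf.map_mul x y)).trans (hg.map_mul _ _)

theorem IsHom.prodMap_id {O : Type w} [EffectMonoid O] {f : M → N} (hf : IsHom f) :
    IsHom (Prod.map (id : O → O) f) where
  map_one := Prod.ext rfl hf.map_one
  map_osum x y h := by
    obtain ⟨h', e⟩ := hf.map_osum x.2 y.2 h.2
    exact ⟨⟨h.1, h'⟩, Prod.ext rfl e⟩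
  map_mul x y := Prod.ext rfl (hf.map_mul x.2 y.2)

/-- The composition of isomorphisms of effect monoids. -/
def Iso.trans {O : Type w} [EffectMonoid O] (e : Iso M N) (e' : Iso N O) : Iso M O where
  toEquiv := e.toEquiv.trans e'.toEquiv
  isHom_toFun := e'.isHom_toFun.comp e.isHom_toFun
  isHom_invFun := e.isHom_invFun.comp e'.isHom_invFun

/-- An isomorphism applied to the second summand of a direct sum. -/
def Iso.prodCongrRight (O : Type w) [EffectMonoid O] (e : Iso M N) : Iso (O × M) (O × N) where
  toEquiv := (Equiv.refl O).prodCongr e.toEquiv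
  isHom_toFun := e.isHom_toFun.prodMap_id
  isHom_invFun := e.isHom_invFun.prodMap_id

end Morphisms

/-! ### Splitting along an idempotent -/

section Corner

variable {M : Type u} [EffectMonoid M] {p : M}

/-- The corner of an effect monoid at an idempotent: the elements below it. -/
def Corner (p : M) (_ : IsIdempotentElem p) : Type u := {x : M // x ≤ p}

variable (hp : IsIdempotentElem p)

instance : EffectMonoid (Corner p hp) where
  zero := ⟨0, zero_le_all p⟩
  -- For `x ≤ p` this is the difference of `p` and `x`; the unit of the corner thus appears as `p *
  -- 1`.
  compl x := ⟨p * x.1ᶜ, mul_le_left p _⟩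
  mul x y := ⟨x.1 * y.1, (mul_le_left _ _).trans x.2⟩
  Perp x y := Perp x.1 y.1
  osum x y h := ⟨osum x.1 y.1 h, osum_le hp x.2 y.2 h⟩
  osum_comm x y h :=
    ⟨(osum_comm _ _ h).choose, Subtype.ext (osum_comm _ _ h).choose_spec⟩
  osum_zero x := ⟨(osum_zero x.1).choose, Subtype.ext (osum_zero x.1).choose_spec⟩
  osum_assoc x y z h₁ h₂ := by
    obtain ⟨h₃, h₄, e⟩ := osum_assoc x.1 y.1 z.1 h₁ h₂
    exact ⟨h₃, h₄, Subtype.ext e⟩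
  osum_compl x := by
    have h := mul_add_mul_compl p x.1
    rw [mul_eq_of_le hp x.2] at h
    obtain ⟨h, e⟩ := of_add_eq_of.1 h
    exact ⟨h, Subtype.ext (e.trans (mul_one' p).symm)⟩
  compl_unique x y h e := by
    have h' := mul_add_mul_compl p x.1
    rw [mul_eq_of_le hp x.2] at h'
    refine Subtype.ext (of_inj.1 (add_left_cancel_of (of_add_eq_of.2 ⟨h, ?_⟩) h'))
    exact (congrArg Subtype.val e).trans (mul_one' p)
  eq_zero_of_perp_one x h := by
    have h : Perp x.1 (p * 1) := h
    rw [mul_one', perp_iff_le_compl] at h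
    exact Subtype.ext ((mul_eq_of_le hp x.2).symm.trans (mul_eq_zero_of_le_compl hp h))
  mul_unit a := Subtype.ext <| by
    change a.1 * (p * 1) = a.1
    rw [mul_one', mul_eq_of_le' hp a.2]
  unit_mul a := Subtype.ext <| by
    change p * 1 * a.1 = a.1
    rw [mul_one', mul_eq_of_le hp a.2]
  mul_osum a b c h :=
    ⟨(mul_osum a.1 b.1 c.1 h).choose, Subtype.ext (mul_osum a.1 b.1 c.1 h).choose_spec⟩
  osum_mul a b c h :=
    ⟨(osum_mul a.1 b.1 c.1 h).choose, Subtype.ext (osum_mul a.1 b.1 c.1 h).choose_spec⟩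
  mul_assoc' a b c := Subtype.ext (mul_assoc' _ _ _)

theorem Corner.le_iff {x y : Corner p hp} : x ≤ y ↔ x.1 ≤ y.1 := by
  constructor
  · rintro ⟨z, h, rfl⟩
    exact ⟨z.1, h, rfl⟩
  · rintro ⟨z, h, e⟩
    have hz : z ≤ y.1 := of_le_of_iff.2 ⟨x.1, (add_comm _ _).trans (of_add_eq_of.2 ⟨h, e⟩)⟩
    exact ⟨⟨z, hz.trans y.2⟩, h, Subtype.ext e⟩

theorem Corner.isDirectedComplete (hM : IsDirectedComplete M) :
    IsDirectedComplete (Corner p hp) := by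
  intro S hne hS
  obtain ⟨s, hs⟩ := hM (Subtype.val '' S) (hne.image _) (by
    rintro _ ⟨x, hx, rfl⟩ _ ⟨y, hy, rfl⟩
    obtain ⟨z, hz, hxz, hyz⟩ := hS x hx y hy
    exact ⟨z.1, ⟨z, hz, rfl⟩, (Corner.le_iff hp).1 hxz, (Corner.le_iff hp).1 hyz⟩)
  refine ⟨⟨s, hs.2 ?_⟩, fun x hx => (Corner.le_iff hp).2 (hs.1 ⟨x, hx, rfl⟩), fun b hb =>
    (Corner.le_iff hp).2 (hs.2 ?_)⟩
  · rintro _ ⟨x, -, rfl⟩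
    exact x.2
  · rintro _ ⟨x, hx, rfl⟩
    exact (Corner.le_iff hp).1 (hb hx)

/-- The projection of an effect monoid onto a corner. -/
def Corner.proj (x : M) : Corner p hp := ⟨p * x, mul_le_left p x⟩

theorem Corner.isHom_proj : IsHom (Corner.proj hp) where
  map_one := rfl
  map_osum x y h := by
    obtain ⟨h', e⟩ := mul_osum p x y h
    exact ⟨h', Subtype.ext e⟩
  map_mul x y := Subtype.ext <| by
    change p * (x * y) = p * x * (p * y)
    rw [mul_assoc', mul_assoc', mul_eq_of_le' hp (mul_le_left p x)]

/-- An idempotent splits an effect monoid into the two complementary corners. -/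
noncomputable def cornerIso :
    Iso M (Corner pᶜ (isIdempotentElem_compl hp) × Corner p hp) :=
  Iso.ofBijective (fun x => (Corner.proj _ x, Corner.proj hp x))
    { map_one := rfl
      map_osum := fun x y h => by
        obtain ⟨h₁, e₁⟩ := (Corner.isHom_proj (isIdempotentElem_compl hp)).map_osum x y h
        obtain ⟨h₂, e₂⟩ := (Corner.isHom_proj hp).map_osum x y h
        exact ⟨⟨h₁, h₂⟩, Prod.ext e₁ e₂⟩
      map_mul := fun x y => Prod.ext
        ((Corner.isHom_proj (isIdempotentElem_compl hp)).map_mul x y)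
        ((Corner.isHom_proj hp).map_mul x y) }
    (by
      have hq := isIdempotentElem_compl hp
      constructor
      · intro x y h
        obtain ⟨h₁, h₂⟩ := Prod.ext_iff.1 h
        have h₁ : pᶜ * x = pᶜ * y := congrArg Subtype.val h₁
        have h₂ : p * x = p * y := congrArg Subtype.val h₂
        rw [← of_inj, ← mul_add_compl_mul x p, h₁, h₂, mul_add_compl_mul]
      · rintro ⟨⟨u, hu⟩, ⟨v, hv⟩⟩
        have h := of_add_osum (perp_of_le_compl hu hv)
        refine ⟨osum u v (perp_of_le_compl hu hv), Prod.ext (Subtype.ext ?_)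
          (Subtype.ext ?_)⟩
        · have e := mul_add_of pᶜ h
          rw [mul_eq_of_le hq hu, mul_eq_zero_of_le_compl hq (by rwa [compl_compl_eq]), of_zero,
            add_zero, of_inj] at e
          exact e.symm
        · have e := mul_add_of p h
          rw [mul_eq_of_le hp hv, mul_eq_zero_of_le_compl hp hu, of_zero,
            zero_add, of_inj] at e
          exact e.symm)
    (by
      rintro x y ⟨h₁, h₂⟩
      have h₁ : Perp (pᶜ * x) (pᶜ * y) := h₁
      have h₂ : Perp (p * x) (p * y) := h₂
      -- The two componentwise sums lie below `pᶜ` and `p`, so they are summable; regrouping gives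
      -- the sum of `x` and `y`.
      have h := of_add_osum (perp_of_le_compl
        (osum_le (isIdempotentElem_compl hp) (mul_le_left _ _) (mul_le_left _ _) h₁)
        (osum_le hp (mul_le_left _ _) (mul_le_left _ _) h₂))
      rw [← of_add_osum h₁, ← of_add_osum h₂, add_add_add_comm, add_comm (of (pᶜ * x)),
        add_comm (of (pᶜ * y)), mul_add_compl_mul, mul_add_compl_mul] at h
      exact perp_of_add_eq h)

end Corner

/-! ### All elements idempotent: the Boolean case -/

section Boolean

variable {N : Type u} [EffectMonoid N] (hN : ∀ x : N, IsIdempotentElem x)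

include hN in
theorem mul_eq_zero_iff_le_compl {x y : N} : x * y = 0 ↔ x ≤ yᶜ := by
  constructor
  · intro h
    have e := mul_add_mul_compl x y
    rw [h, of_zero, zero_add, of_inj] at e
    rw [← e]
    exact mul_le_right x _
  · intro h
    rw [mul_comm_of_isIdempotentElem (hN x)]
    exact mul_eq_zero_of_le_compl (hN y) h

-- Multiplication by `x` has a right adjoint, so it preserves joins; this is the source of
-- distributivity.
include hN in
theorem mul_le_iff {x y z : N} : x * y ≤ z ↔ y ≤ (x * zᶜ)ᶜ := by
  rw [← mul_eq_zero_iff_le_compl hN, ← compl_compl_eq z, ← mul_eq_zero_iff_le_compl hN,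
    compl_compl_eq, mul_comm_of_isIdempotentElem (hN x) y, mul_assoc']

/-- An effect monoid all of whose elements are idempotent is a distributive lattice. -/
abbrev distribLattice : DistribLattice N :=
  letI : Lattice N :=
    { (inferInstance : PartialOrder N) with
      inf := fun x y => x * y
      sup := fun x y => (xᶜ * yᶜ)ᶜ
      inf_le_left := mul_le_left
      inf_le_right := mul_le_right
      le_inf := fun x y z hxy hxz => by
        rw [← (hN x).eq]
        exact (mul_le_mul_left_of x hxz).trans (mul_le_mul_right_of z hxy)
      le_sup_left := fun x y => le_compl_comm.1 (mul_le_left _ _)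
      le_sup_right := fun x y => le_compl_comm.1 (mul_le_right _ _)
      sup_le := fun x y z hxz hyz => by
        rw [← compl_compl_eq z]
        refine compl_le_compl_of_le ?_
        rw [← (hN zᶜ).eq]
        exact (mul_le_mul_left_of _ (compl_le_compl_of_le hyz)).trans
          (mul_le_mul_right_of _ (compl_le_compl_of_le hxz)) }
  DistribLattice.ofInfSupLe fun a b c => by
    refine (mul_le_iff hN).2 (sup_le ?_ ?_)
    · exact (mul_le_iff hN).1 le_sup_left
    · exact (mul_le_iff hN).1 le_sup_right

/-- An effect monoid all of whose elements are idempotent is a Boolean algebra. -/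
abbrev booleanAlgebra : BooleanAlgebra N :=
  { distribLattice hN, (inferInstance : Compl N) with
    top := 1
    bot := 0
    inf_compl_le_bot := fun x => (mul_compl_self (hN x)).le
    top_le_sup_compl := fun x => by
      change 1 ≤ (xᶜ * xᶜᶜ)ᶜ
      rw [mul_compl_self (hN xᶜ), compl_zero_eq_one]
    le_top := le_one_all
    bot_le := zero_le_all }

-- Finite joins of elements of `S` form a directed set with the same upper bounds; the empty join
-- keeps it non-empty.
include hN in
theorem exists_isLUB (h : IsDirectedComplete N) (S : Set N) : ∃ s, IsLUB S s := by
  let := booleanAlgebra hN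
  classical
  obtain ⟨s, hs⟩ := h {x | ∃ F : Finset N, ↑F ⊆ S ∧ x = F.sup id} ⟨⊥, ∅, by simp⟩ (by
    rintro _ ⟨F, hF, rfl⟩ _ ⟨G, hG, rfl⟩
    refine ⟨_, ⟨F ∪ G, ?_, rfl⟩, Finset.sup_mono Finset.subset_union_left,
      Finset.sup_mono Finset.subset_union_right⟩
    rw [Finset.coe_union]
    exact Set.union_subset hF hG)
  refine ⟨s, fun x hx => hs.1 ⟨{x}, by simpa using hx, by simp⟩, fun b hb => hs.2 ?_⟩
  rintro _ ⟨F, hF, rfl⟩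
  exact Finset.sup_le fun x hx => hb (hF hx)

/-- A directed-complete effect monoid all of whose elements are idempotent is a complete Boolean
algebra. -/
noncomputable abbrev completeBooleanAlgebra (h : IsDirectedComplete N) :
    CompleteBooleanAlgebra N :=
  { booleanAlgebra hN with
    sSup := fun S => (exists_isLUB hN h S).choose
    sInf := fun S => (exists_isLUB hN h (lowerBounds S)).choose
    isLUB_sSup := fun S => (exists_isLUB hN h S).choose_spec
    isGLB_sInf := fun S =>
      isLUB_lowerBounds.1 (exists_isLUB hN h (lowerBounds S)).choose_spec }

include hN in
theorem exists_iso_completeBooleanAlgebra (h : IsDirectedComplete N) :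
    ∃ (B : Type u) (_ : CompleteBooleanAlgebra B),
      letI : EffectMonoid B := ofBooleanAlgebra B
      Nonempty (Iso N B) := by
  let L := completeBooleanAlgebra hN h
  refine ⟨N, L, ⟨@Iso.ofBijective N N _ (ofBooleanAlgebra N) id ?_ Function.bijective_id ?_⟩⟩
  · refine @IsHom.mk N N _ (ofBooleanAlgebra N) id rfl (fun x y k => ?_) fun x y => rfl
    have hd : Disjoint x y := by
      rw [disjoint_iff]
      exact (mul_eq_zero_iff_le_compl hN).2 (perp_iff_le_compl.1 k)
    -- The sum is the join: the join is idempotent, and the elements below an idempotent are closed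
    -- under existing sums.
    refine ⟨hd, le_antisymm ?_ ?_⟩
    · refine osum_le (hN _) ?_ ?_ k
      · exact le_sup_left (a := x) (b := y)
      · exact le_sup_right (a := x) (b := y)
    · refine sup_le (a := x) (b := y) (c := osum x y k) ?_ ?_
      · exact ⟨y, k, rfl⟩
      · rw [← of_le_of, ← of_add_osum k, add_comm]
        exact le_add _ _
  · intro x y hd
    have hd : Disjoint x y := hd
    rw [perp_iff_le_compl, ← mul_eq_zero_iff_le_compl hN]
    exact disjoint_iff.1 hd

end Boolean

/-! ### Real scalars from a half of the unit -/

section Convex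

variable {M : Type u} [EffectMonoid M]

theorem mul_nsmul_of (a : M) {x y : M} {n : ℕ} (h : n • of x = of y) :
    n • of (a * x) = of (a * y) := by
  induction n generalizing y with
  | zero =>
    rw [zero_nsmul, ← of_zero, of_inj] at h
    rw [← h, mul_zero', zero_nsmul, of_zero]
  | succ n ih =>
    rw [succ_nsmul] at h ⊢
    obtain ⟨z, hz⟩ := exists_of_le ((le_add _ _).trans_eq h)
    rw [hz] at h
    rw [ih hz, mul_add_of a h]

variable {a : M} (ha : of a + of a = of 1)
include ha

theorem add_half_mul (x : M) : of (a * x) + of (a * x) = of x :=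
  (add_mul_of x ha).trans (congrArg of (one_mul' x))

/-- Halves are unique: doubling `a * x` gives `x`, and by additivity it also gives `a * z`. -/
theorem eq_of_two_nsmul_eq {x y z : M} (hx : 2 • of x = of z) (hy : 2 • of y = of z) : x = y := by
  rw [← of_inj, ← add_half_mul ha x, ← add_half_mul ha y, ← two_nsmul, ← two_nsmul,
    mul_nsmul_of a hx, mul_nsmul_of a hy]

theorem eq_of_two_pow_nsmul_eq {m : ℕ} {x y z : M} (hx : 2 ^ m • of x = of z)
    (hy : 2 ^ m • of y = of z) : x = y := by
  induction m generalizing z with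
  | zero =>
    rw [pow_zero, one_nsmul] at hx hy
    exact of_inj.1 (hx.trans hy.symm)
  | succ m ih =>
    rw [pow_succ, mul_nsmul] at hx hy
    obtain ⟨x', -, hx', -⟩ := exists_of_add_eq ((two_nsmul _).symm.trans hx)
    obtain ⟨y', -, hy', -⟩ := exists_of_add_eq ((two_nsmul _).symm.trans hy)
    refine ih hx' (hy'.trans (congrArg of ?_))
    exact eq_of_two_nsmul_eq ha (hy' ▸ hy) (hx' ▸ hx)

theorem exists_two_pow_nsmul_eq (m : ℕ) (u : M) : ∃ y : M, 2 ^ m • of y = of u := by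
  induction m with
  | zero => exact ⟨u, one_nsmul _⟩
  | succ m ih =>
    obtain ⟨y, hy⟩ := ih
    refine ⟨a * y, ?_⟩
    rw [pow_succ', mul_nsmul, two_nsmul, add_half_mul ha, hy]

theorem eq_two_pow_nsmul {m n : ℕ} {u y z : M} (hy : 2 ^ m • of y = of u)
    (hz : 2 ^ (m + n) • of z = of u) : of y = 2 ^ n • of z := by
  obtain ⟨w, hw⟩ := exists_of_le
    ((nsmul_mono_left (of z) (Nat.pow_le_pow_right two_pos (Nat.le_add_left n m))).trans_eq hz)
  rw [pow_add, mul_comm, mul_nsmul, hw] at hz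
  rw [hw, eq_of_two_pow_nsmul_eq ha hy hz]

/-- Compares `k / 2 ^ m` and `l / 2 ^ n` times `u` over the common denominator `2 ^ (m + n)`. -/
theorem nsmul_le_nsmul_of {m n k l : ℕ} {u y z : M} (hy : 2 ^ m • of y = of u)
    (hz : 2 ^ n • of z = of u) (h : k * 2 ^ n ≤ l * 2 ^ m) : k • of y ≤ l • of z := by
  obtain ⟨w, hw⟩ := exists_two_pow_nsmul_eq ha (m + n) u
  rw [eq_two_pow_nsmul ha hy hw, eq_two_pow_nsmul ha hz ((add_comm n m).symm ▸ hw),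
    ← mul_nsmul, ← mul_nsmul]
  refine nsmul_mono_left _ ?_
  rwa [mul_comm, mul_comm (2 ^ m)]

omit ha in
/-- The dyadic multiples of `u` by scalars that are at most `l`. -/
def dyadicBelow (u : M) (l : ℝ) : Set M :=
  {x | ∃ (k m : ℕ) (y : M), (k : ℝ) ≤ l * 2 ^ m ∧ 2 ^ m • of y = of u ∧ of x = k • of y}

omit ha in
theorem zero_mem_dyadicBelow (u : M) {l : ℝ} (hl : 0 ≤ l) : 0 ∈ dyadicBelow u l :=
  ⟨0, 0, u, by simpa using hl, one_nsmul _, (zero_nsmul _).symm⟩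

theorem exists_isLUB_dyadicBelow (hM : IsDirectedComplete M) (u : M) {l : ℝ} (hl : 0 ≤ l) :
    ∃ s, IsLUB (dyadicBelow u l) s := by
  refine hM _ ⟨0, zero_mem_dyadicBelow u hl⟩ ?_
  rintro x ⟨k, m, y, hk, hy, hx⟩ x' ⟨k', m', y', hk', hy', hx'⟩
  rcases le_total (k * 2 ^ m') (k' * 2 ^ m) with h | h
  · refine ⟨x', ⟨k', m', y', hk', hy', hx'⟩, of_le_of.1 ?_, le_rfl⟩
    rw [hx, hx']
    exact nsmul_le_nsmul_of ha hy hy' h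
  · refine ⟨x, ⟨k, m, y, hk, hy, hx⟩, le_rfl, of_le_of.1 ?_⟩
    rw [hx, hx']
    exact nsmul_le_nsmul_of ha hy' hy h

omit ha in
/-- A map on the unit interval that preserves the existing sums. -/
def IsAdditive (f : unitInterval → M) : Prop :=
  ∀ l m n : unitInterval, (l : ℝ) + m = n → of (f l) + of (f m) = of (f n)

omit ha in
theorem IsAdditive.nsmul {f : unitInterval → M} (hf : IsAdditive f) {k : ℕ}
    {s t : unitInterval} (h : (s : ℝ) = k * t) : of (f s) = k • of (f t) := by
  induction k generalizing s with
  | zero =>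
    have hs : (s : ℝ) = 0 := by simpa using h
    rw [zero_nsmul, eq_of_add_eq_left (hf s s s (by rw [hs, add_zero])), of_zero]
  | succ k ih =>
    have hs : (s : ℝ) = k * t + t := by rw [h]; push_cast; ring
    have h0 : (0 : ℝ) ≤ k * t := mul_nonneg k.cast_nonneg t.2.1
    have h1 : (k * t : ℝ) ≤ 1 := by linarith [s.2.2, t.2.1]
    rw [succ_nsmul, ← ih (s := ⟨k * t, h0, h1⟩) rfl]
    exact (hf _ _ _ hs.symm).symm

/-- Additivity forces continuity from below: the gap between the dyadic supremum and `f l` is at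
most `f r` for arbitrarily small `r`, hence infinitesimal. -/
theorem IsAdditive.isLUB (hM : IsDirectedComplete M) {f : unitInterval → M}
    (hf : IsAdditive f) (l : unitInterval) : IsLUB (dyadicBelow (f 1) l) (f l) := by
  have hpow : ∀ n : ℕ, (0 : ℝ) < 2 ^ n := fun n => by positivity
  have hinv : ∀ n : ℕ, (1 / 2 ^ n : ℝ) ∈ unitInterval := fun n =>
    ⟨by positivity, (div_le_one (hpow n)).2 (one_le_pow₀ one_le_two)⟩
  have hhalf : ∀ n : ℕ, 2 ^ n • of (f ⟨1 / 2 ^ n, hinv n⟩) = of (f 1) := fun n =>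
    (hf.nsmul (by push_cast; exact (mul_one_div_cancel (hpow n).ne').symm)).symm
  have hsplit : ∀ (k n : ℕ) (hk : (k : ℝ) ≤ l * 2 ^ n),
      ∃ r : unitInterval, (r : ℝ) = l - k / 2 ^ n ∧
        k • of (f ⟨1 / 2 ^ n, hinv n⟩) + of (f r) = of (f l) := by
    intro k n hk
    have h1 : (k / 2 ^ n : ℝ) ≤ l := (div_le_iff₀ (hpow n)).2 hk
    have h0 : (0 : ℝ) ≤ k / 2 ^ n := by positivity
    have hr : (l - k / 2 ^ n : ℝ) ∈ unitInterval := ⟨by linarith, by linarith [l.2.2]⟩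
    refine ⟨⟨_, hr⟩, rfl, ?_⟩
    rw [← hf.nsmul (s := ⟨k / 2 ^ n, h0, h1.trans l.2.2⟩) (div_eq_mul_one_div _ _)]
    exact hf _ _ _ (add_sub_cancel _ _)
  obtain ⟨s, hs⟩ := exists_isLUB_dyadicBelow ha hM (f 1) l.2.1
  have hsl : s ≤ f l := hs.2 <| by
    rintro x ⟨k, m, y, hk, hy, hx⟩
    obtain ⟨r, -, hr⟩ := hsplit k m hk
    rw [← of_le_of, hx, eq_of_two_pow_nsmul_eq ha hy (hhalf m), ← hr]
    exact le_add _ _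
  obtain ⟨d, hd⟩ := of_le_of_iff.1 hsl
  have hd0 : d = 0 := by
    refine eq_zero_of_nsmul_ne_top hM fun n => ?_
    -- Rounding `l` down at level `n` leaves `r` with `2 ^ n * r ≤ 1`, so `2 ^ n • of d` is defined,
    -- and with it `n • of d`.
    set k := ⌊(l : ℝ) * 2 ^ n⌋₊
    have hk : (k : ℝ) ≤ l * 2 ^ n := Nat.floor_le (mul_nonneg l.2.1 (hpow n).le)
    obtain ⟨r, hr, he⟩ := hsplit k n hk
    obtain ⟨x, hx⟩ := exists_of_le ((le_add _ _).trans_eq he)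
    have hxs : x ≤ s := hs.1 ⟨k, n, _, hk, hhalf n, hx.symm⟩
    have hdr : of d ≤ of (f r) := by
      rw [hx] at he
      refine le_of_add_le_add_of ?_ he
      rw [he, ← hd]
      exact add_le_add_left (of_le_of.2 hxs) _
    have hr1 : (2 ^ n * r : ℝ) ≤ 1 := by
      have h1 := (Nat.lt_floor_add_one ((l : ℝ) * 2 ^ n)).le
      have h2 : (2 ^ n * (k / 2 ^ n) : ℝ) = k := mul_div_cancel₀ _ (hpow n).ne'
      rw [hr, mul_sub, h2]
      linarith
    have hfin := hf.nsmul (k := 2 ^ n) (t := r)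
      (s := ⟨2 ^ n * r, mul_nonneg (hpow n).le r.2.1, hr1⟩) (by push_cast; rfl)
    obtain ⟨w, hw⟩ := exists_of_le (((nsmul_mono_left (of d) Nat.lt_two_pow_self.le).trans
      (nsmul_le_nsmul_right hdr _)).trans_eq hfin.symm)
    rw [hw]
    exact of_ne_top w
  rw [hd0, of_zero, add_zero, of_inj] at hd
  rwa [← hd]

/-- Additive maps on the unit interval are determined by their value at `1`. -/
theorem IsAdditive.eq (hM : IsDirectedComplete M) {f g : unitInterval → M}
    (hf : IsAdditive f) (hg : IsAdditive g) (h : f 1 = g 1) : f = g := by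
  funext l
  have := hg.isLUB ha hM l
  rw [← h] at this
  exact (hf.isLUB ha hM l).unique this

/-- Each `f l` is the supremum of the dyadic multiples of `1` below `l`. Adding dyadics gives one
inequality for sums; the defect `d` of the other is infinitesimal. -/
theorem exists_isAdditive (hM : IsDirectedComplete M) :
    ∃ f : unitInterval → M, IsAdditive f ∧ f 1 = 1 := by
  choose f hf using fun l : unitInterval => exists_isLUB_dyadicBelow ha hM (1 : M) l.2.1
  have hpow : ∀ n : ℕ, (0 : ℝ) < 2 ^ n := fun n => by positivity
  refine ⟨f, fun l l' ν hν => ?_, le_antisymm (le_one_all _)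
    ((hf 1).1 ⟨1, 0, 1, by simp, one_nsmul _, (one_nsmul _).symm⟩)⟩
  have hle : of (f l) + of (f l') ≤ of (f ν) := by
    refine add_le_of_isLUB ⟨0, zero_mem_dyadicBelow 1 l.2.1⟩ (hf l) fun x hx => ?_
    rw [add_comm]
    refine add_le_of_isLUB ⟨0, zero_mem_dyadicBelow 1 l'.2.1⟩ (hf l') fun x' hx' => ?_
    obtain ⟨k, m, y, hk, hy, hx⟩ := hx
    obtain ⟨k', m', y', hk', hy', hx'⟩ := hx'
    obtain ⟨w, hw⟩ := exists_two_pow_nsmul_eq ha (m + m') (1 : M)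
    have hc : ((2 ^ m * k' + 2 ^ m' * k : ℕ) : ℝ) ≤ ν * 2 ^ (m + m') := by
      push_cast
      rw [← hν, pow_add]
      nlinarith [mul_le_mul_of_nonneg_left hk (hpow m').le,
        mul_le_mul_of_nonneg_left hk' (hpow m).le]
    have hc' : 2 ^ m * k' + 2 ^ m' * k ≤ 2 ^ (m + m') := by
      have : (ν * 2 ^ (m + m') : ℝ) ≤ 2 ^ (m + m') := mul_le_of_le_one_left (hpow _).le ν.2.2
      exact_mod_cast hc.trans this
    obtain ⟨v, hv⟩ := exists_of_le ((nsmul_mono_left (of w) hc').trans_eq hw)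
    rw [hx, hx', eq_two_pow_nsmul ha hy hw,
      eq_two_pow_nsmul ha hy' ((add_comm m' m).symm ▸ hw), ← mul_nsmul, ← mul_nsmul,
      ← add_nsmul, hv, of_le_of]
    exact (hf ν).1 ⟨_, _, w, hc, hw, hv.symm⟩
  obtain ⟨d, hd⟩ := le_iff_exists.1 hle
  obtain ⟨-, d, -, rfl⟩ := exists_of_add_eq hd
  have hd0 : d = 0 := by
    refine eq_zero_of_nsmul_ne_top hM fun n => ?_
    -- The defect will be bounded by two grid steps `y`; the extra level absorbs that factor, giving
    -- `2 ^ n • of d ≤ of 1`.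
    obtain ⟨y, hy⟩ := exists_two_pow_nsmul_eq ha (n + 1) (1 : M)
    set P : ℝ := 2 ^ (n + 1) with hP
    have hP0 : 0 < P := hpow (n + 1)
    have fin : ∀ t : unitInterval, ∃ x ∈ dyadicBelow (1 : M) t, of x = ⌊(t : ℝ) * P⌋₊ • of y := by
      intro t
      have h1 : (⌊(t : ℝ) * P⌋₊ : ℝ) ≤ t * P := Nat.floor_le (mul_nonneg t.2.1 hP0.le)
      have h2 : ⌊(t : ℝ) * P⌋₊ ≤ 2 ^ (n + 1) := by
        refine Nat.floor_le_of_le ?_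
        push_cast
        exact mul_le_of_le_one_left hP0.le t.2.2
      obtain ⟨x, hx⟩ := exists_of_le ((nsmul_mono_left (of y) h2).trans_eq hy)
      exact ⟨x, ⟨_, n + 1, y, h1, hy, hx.symm⟩, hx.symm⟩
    obtain ⟨x, hx, hxe⟩ := fin l
    obtain ⟨x', hx', hxe'⟩ := fin l'
    set k := ⌊(l : ℝ) * P⌋₊
    set k' := ⌊(l' : ℝ) * P⌋₊
    set c := ⌈(ν : ℝ) * P⌉₊
    have hk : (k : ℝ) ≤ l * P := Nat.floor_le (mul_nonneg l.2.1 hP0.le)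
    have hk' : (k' : ℝ) ≤ l' * P := Nat.floor_le (mul_nonneg l'.2.1 hP0.le)
    have hk1 : (l * P : ℝ) < k + 1 := Nat.lt_floor_add_one _
    have hk1' : (l' * P : ℝ) < k' + 1 := Nat.lt_floor_add_one _
    have hc : (ν * P : ℝ) ≤ c := Nat.le_ceil _
    have hc2 : c ≤ 2 ^ (n + 1) := by
      refine Nat.ceil_le.2 ?_
      push_cast
      exact mul_le_of_le_one_left hP0.le ν.2.2
    have hνP : (ν * P : ℝ) = l * P + l' * P := by rw [← hν, add_mul]
    have hkc : k + k' ≤ c := by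
      have : (k + k' : ℝ) ≤ c := by linarith
      exact_mod_cast this
    -- Each of the two floors loses less than one grid step, so `ν * P < k + k' + 2`.
    have hck : c ≤ k + k' + 2 := by
      refine Nat.ceil_le.2 ?_
      push_cast
      linarith
    obtain ⟨j, hj⟩ := Nat.exists_eq_add_of_le hkc
    obtain ⟨e, he⟩ := exists_of_le ((nsmul_mono_left (of y) hc2).trans_eq hy)
    have hfe : f ν ≤ e := (hf ν).2 <| by
      rintro z ⟨i, m, w, hi, hw, hz⟩
      rw [← of_le_of, ← he, hz]
      refine nsmul_le_nsmul_of ha hw hy ?_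
      have h1 : (i * P : ℝ) ≤ c * 2 ^ m := by
        nlinarith [mul_le_mul_of_nonneg_left hi hP0.le, mul_le_mul_of_nonneg_left hc (hpow m).le]
      rw [hP] at h1
      exact_mod_cast h1
    have hdj : of d ≤ j • of y := by
      refine le_of_add_le_add_of (u := (k + k') • of y) (t := e) ?_
        (by rw [← add_nsmul, ← hj, he])
      rw [← add_nsmul, ← hj, he]
      refine le_trans ?_ (of_le_of.2 hfe)
      rw [← hd, add_nsmul, ← hxe, ← hxe']
      exact add_le_add_left (add_le_add (of_le_of.2 ((hf l).1 hx)) (of_le_of.2 ((hf l').1 hx'))) _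
    have hd2 : of d ≤ 2 • of y := hdj.trans (nsmul_mono_left _ (by omega))
    obtain ⟨w, hw⟩ := exists_of_le (u := n • of d) (y := 1) <|
      ((nsmul_mono_left (of d) Nat.lt_two_pow_self.le).trans
        (nsmul_le_nsmul_right hd2 _)).trans_eq (by rw [← mul_nsmul, ← pow_succ', hy])
    rw [hw]
    exact of_ne_top w
  rwa [hd0, of_zero, add_zero] at hd

/-- A directed-complete effect monoid whose unit has a half is convex. -/
theorem isConvex_of_half (hM : IsDirectedComplete M) : IsConvex M := by
  obtain ⟨f, hf, hf1⟩ := exists_isAdditive ha hM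
  have hmul : ∀ l m, f (l * m) = f l * f m := by
    intro l m
    -- With `m` fixed, both sides are additive in `l` and take the value `f m` at `1`.
    refine congrFun (IsAdditive.eq ha hM (f := fun l => f (l * m)) (g := fun l => f l * f m)
      ?_ ?_ ?_) l
    · intro l₁ l₂ l₃ h
      refine hf _ _ _ ?_
      push_cast
      rw [← add_mul, h]
    · exact fun l₁ l₂ l₃ h => add_mul_of (f m) (hf _ _ _ h)
    · rw [one_mul, hf1, one_mul']
  refine ⟨fun l x => f l * x, fun l m x => ?_, fun l m n x h => ?_, fun l x y h => ?_,
    fun x => ?_⟩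
  · exact (mul_assoc' _ _ _).trans (congrArg (· * x) (hmul l m).symm)
  · exact of_add_eq_of.1 (add_mul_of x (hf l m n h))
  · exact mul_osum (f l) x y h
  · exact (congrArg (· * x) hf1).trans (one_mul' x)

end Convex

end EffectMonoid

/-! ### Assembling the decomposition -/

open EffectAlgebra in
theorem mainTheorem7 (M : Type u) [EffectMonoid M] (hM : IsDirectedComplete M) :
    (∃ a : M, Maximal (fun x : M => Perp x x) a) ∧
    ∀ (a : M) (ha : Maximal (fun x : M => Perp x x) a),
      IsIdempotentElem (osum a a ha.prop)ᶜ ∧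
      (∀ s : M, s ≤ (osum a a ha.prop)ᶜ → IsIdempotentElem s) ∧
      ∃ (M₁ : Type u) (_ : EffectMonoid M₁) (M₂ : Type u) (_ : CompleteBooleanAlgebra M₂),
        IsConvex M₁ ∧ IsDirectedComplete M₁ ∧
        letI : EffectMonoid M₂ := EffectMonoid.ofBooleanAlgebra M₂
        ∃ e : EffectMonoid.Iso M (M₁ × M₂),
          e.toEquiv (osum a a ha.prop)ᶜ = ((0 : M₁), (⊤ : M₂)) := by
  refine ⟨exists_maximal_perp_self hM, fun a ha => ?_⟩
  have hp := EffectMonoid.isIdempotentElem_of_maximal ha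
  refine ⟨hp, fun s hs => EffectMonoid.isIdempotentElem_of_le_of_maximal ha hs, ?_⟩
  have hidem : ∀ x : EffectMonoid.Corner _ hp, IsIdempotentElem x := fun x =>
    Subtype.ext (EffectMonoid.isIdempotentElem_of_le_of_maximal ha x.2)
  obtain ⟨B, iB, ⟨g⟩⟩ := EffectMonoid.exists_iso_completeBooleanAlgebra hidem
    (EffectMonoid.Corner.isDirectedComplete hp hM)
  have hq := EffectMonoid.isIdempotentElem_compl hp
  have hq1 := EffectMonoid.Corner.isDirectedComplete hq hM
  have haq : a ≤ (osum a a ha.prop)ᶜᶜ := by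
    rw [compl_compl_eq]
    exact ⟨a, ha.prop, rfl⟩
  -- The element `a` itself is the half of the unit `a ⊕ a` of this corner.
  refine ⟨EffectMonoid.Corner _ hq, inferInstance, B, iB,
    EffectMonoid.isConvex_of_half (a := ⟨a, haq⟩) ?_ hq1, hq1, ?_⟩
  · refine Ext.of_add_eq_of.2 ⟨ha.prop, Subtype.ext ?_⟩
    change osum a a ha.prop = (osum a a ha.prop)ᶜᶜ * 1
    rw [EffectMonoid.mul_one', compl_compl_eq]
  let _ : EffectMonoid B := EffectMonoid.ofBooleanAlgebra B
  refine ⟨(EffectMonoid.cornerIso hp).trans (g.prodCongrRight _), Prod.ext ?_ ?_⟩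
  · exact Subtype.ext (EffectMonoid.compl_mul_self hp)
  · have h : EffectMonoid.Corner.proj hp (osum a a ha.prop)ᶜ = 1 :=
      Subtype.ext (hp.eq.trans (EffectMonoid.mul_one' _).symm)
    exact (congrArg g.toFun h).trans (g.isHom_toFun.map_one.trans compl_bot)
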